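/- For real $n>0$ let \[ I(n)=\int_0^1\bigl[x^n+(1-x)^n\bigr]^{1/n}\,dx . \] There is a sequence of real numbers $I_0,I_1,I_2,\dots$ such that \[ I(n)\sim I_0+\frac{I_1}{n}+\frac{I_2}{n^2}+\frac{I_3}{n^3}+\cdots\qquad (n\to\infty), \] that is, for every integer $N\ge 0$, $I(n)-\sum_{j=0}^N I_j n^{-j}=o(n^{-N})$ as $n\to\infty$ through the real numbers. The sequence is uniquely determined by this property, even if $n$ is only allowed to tend to infinity through the integers. For every $p\ge 2$ the coefficient $I_p$ is a polynomial with rational coefficients in the zeta values $\zeta(i)=\sum_{m\ge1}m^{-i}$, $i\ge 2$ an integer; that is, there is a polynomial $P_p$ with rational coefficients in finitely many of the variables $x_2,x_3,\dots$ such that $I_p=P_p(\zeta(2),\zeta(3),\dots)$. -/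

import Mathlib

open Filter Asymptotics

/-- The integral `I(n) = ∫₀¹ [xⁿ + (1 - x)ⁿ]^(1/n) dx`, for a real parameter `n`. -/
noncomputable def normIntegral (n : ℝ) : ℝ :=
  ∫ x in (0 : ℝ)..1, (x ^ n + (1 - x) ^ n) ^ (1 / n)

/-- `f(t) ~ c₀ + c₁ / t + c₂ / t² + ⋯` as `t` tends to infinity along the filter `l`, in the sense
of Poincaré: for every `N`, the error after the term `c_N / t ^ N` is `o(t ^ (-N))`.
The series itself is not required to converge. -/
def HasAsymptoticSeries (l : Filter ℝ) (f : ℝ → ℝ) (c : ℕ → ℝ) : Prop :=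
  ∀ N : ℕ, (fun t : ℝ => f t - ∑ j ∈ Finset.range (N + 1), c j / t ^ j) =o[l]
    (fun t : ℝ => (t ^ N)⁻¹)

/-- The filter of natural numbers tending to infinity, as a filter on `ℝ`. -/
def integersAtTop : Filter ℝ := Filter.map (fun m : ℕ => (m : ℝ)) Filter.atTop

/-- The complex number `z` is a polynomial with rational coefficients in (finitely many of) the
zeta values `ζ(i)`, `i ≥ 2`. -/
def IsRationalPolynomialInZetaValues (z : ℂ) : Prop :=
  ∃ P : MvPolynomial {i : ℕ // 2 ≤ i} ℚ,
    z = MvPolynomial.aeval (fun i : {i : ℕ // 2 ≤ i} => riemannZeta ((i : ℕ) : ℂ)) P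

/-! Write `x = 1/(1+e^(-s))` and `l(t) = log(1+e^(-t))`. The integrand becomes even in `s`, and
scaling `t = ns`, `r = 1/n` gives `I(n) = 2∫w + 2r ∫ (e^(r l(t)) - 1) w(rt) dt` over `(0,∞)`, with
`w(s) = e^(s/2)/(e^(s/2)+e^(-s/2))^3` (`normIntegral_eq`). Expanding both factors in powers of `r`
gives an asymptotic series whose coefficients are combinations of the moments `∫ t^m l^k` with `k ≥
1` (`hasRightExpansion_integral_exp_sub_one`).

The moments are not evaluated one by one; only the combinations that occur are shown to be
polynomials in zeta values. Since `w` is `e^(s/2)` times an even series over `ℚ`, it suffices to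
treat the weights `e^(s/2) s^i` with `i` even. Their generating function in `y` uses the weight
`e^(s/2)(e^(ys)+e^(-ys))`. After the formal reflection `r ↦ -r` this becomes `e^(-bs)+e^(-cs)` with
`b = 1/2-y`, `c = 1/2+y`, and the corresponding integral is `B(rb,rc) - 1/(rbc)`. The Gamma product
gives `rbc B(rb,rc) = exp(∑_{k≥2} (-1)^(k-1) (1-b^k-c^k) ζ(k) r^k/k)`, whose coefficients are
polynomials in `y` over the algebra of zeta values. Dividing by `bc = 1/4-y²`, monic up to sign,
stays over that algebra; the coefficients of `y^i` are the wanted quantities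
(`momentCoeff_exp_mul_X_pow_mem`). -/

/-! ### Calculus of one-sided asymptotic expansions -/

open Topology in
/-- The function `f` has the asymptotic expansion `p` as its argument tends to `0` from the right. -/
def HasRightExpansion (f : ℝ → ℝ) (p : PowerSeries ℝ) : Prop :=
  ∀ N : ℕ, (fun r : ℝ => f r - ∑ i ∈ Finset.range N, PowerSeries.coeff i p * r ^ i) =O[𝓝[>] 0]
    (fun r : ℝ => r ^ N)

open Topology in
theorem Polynomial.isBigO_eval_of_coeff_eq_zero (P : Polynomial ℝ) {N : ℕ}
    (h : ∀ i < N, P.coeff i = 0) :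
    (fun r : ℝ => P.eval r) =O[𝓝[>] 0] (fun r : ℝ => r ^ N) := by
  obtain ⟨Q, rfl⟩ := Polynomial.X_pow_dvd_iff.2 h
  have hQ : (fun r : ℝ => Q.eval r) =O[𝓝[>] 0] (fun _ : ℝ => (1 : ℝ)) :=
    (Q.continuous.tendsto 0).isBigO_one ℝ |>.mono nhdsWithin_le_nhds
  simpa using (isBigO_refl (fun r : ℝ => r ^ N) (𝓝[>] 0)).mul hQ

open Topology in
theorem isBigO_pow_pow_nhdsGT {m n : ℕ} (h : m ≤ n) :
    (fun r : ℝ => r ^ n) =O[𝓝[>] 0] (fun r : ℝ => r ^ m) := by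
  simpa using (Polynomial.X ^ n : Polynomial ℝ).isBigO_eval_of_coeff_eq_zero (N := m)
    (fun i hi => by rw [Polynomial.coeff_X_pow, if_neg (by omega)])

namespace HasRightExpansion

open PowerSeries Topology

variable {f g : ℝ → ℝ} {p q : PowerSeries ℝ}

theorem eval_trunc (p : PowerSeries ℝ) (N : ℕ) (r : ℝ) :
    (trunc N p).eval r = ∑ i ∈ Finset.range N, coeff i p * r ^ i :=
  eval₂_trunc_eq_sum_range r (RingHom.id ℝ) N p

/-- Terms of degree at least `N` are absorbed in the error, so products of truncations and double
sums can serve as approximants without being cut off. -/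
theorem of_polynomial
    (h : ∀ N, ∃ P : Polynomial ℝ, (∀ i < N, P.coeff i = coeff i p) ∧
      (fun r : ℝ => f r - P.eval r) =O[𝓝[>] 0] (fun r : ℝ => r ^ N)) :
    HasRightExpansion f p := by
  intro N
  obtain ⟨P, hP, hf⟩ := h N
  have h2 := (P - trunc N p).isBigO_eval_of_coeff_eq_zero (N := N) (by
    intro i hi
    simp [hP i hi, coeff_trunc, hi])
  refine (hf.add h2).congr_left fun r => ?_
  simp [eval_trunc]

theorem of_ge (h : ∀ N, ∃ M ≥ N,
    (fun r : ℝ => f r - ∑ i ∈ Finset.range M, PowerSeries.coeff i p * r ^ i) =O[𝓝[>] 0]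
    (fun r : ℝ => r ^ M)) : HasRightExpansion f p := by
  refine of_polynomial fun N => ?_
  obtain ⟨M, hM, h⟩ := h N
  refine ⟨trunc M p, fun i hi => by simp [coeff_trunc, hi.trans_le hM], ?_⟩
  simpa [eval_trunc] using h.trans (isBigO_pow_pow_nhdsGT hM)

theorem congr' (hf : HasRightExpansion f p) (h : f =ᶠ[𝓝[>] 0] g) : HasRightExpansion g p :=
  fun N => (hf N).congr' (h.mono fun r hr => by simp [hr]) EventuallyEq.rfl

theorem isBigO_one (hf : HasRightExpansion f p) : f =O[𝓝[>] 0] (fun _ : ℝ => (1 : ℝ)) := by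
  simpa using hf 0

theorem of_eval (P : Polynomial ℝ) : HasRightExpansion (fun r => P.eval r) (P : PowerSeries ℝ) :=
  of_polynomial fun N => ⟨P, by simp, by simpa using isBigO_zero _ _⟩

theorem const (c : ℝ) : HasRightExpansion (fun _ => c) (C c) := by
  simpa using of_eval (Polynomial.C c)

theorem id : HasRightExpansion (fun r => r) X := by
  simpa using of_eval Polynomial.X

theorem add (hf : HasRightExpansion f p) (hg : HasRightExpansion g q) :
    HasRightExpansion (fun r => f r + g r) (p + q) := fun N =>
  ((hf N).add (hg N)).congr_left fun r => by
    simp [add_mul, Finset.sum_add_distrib]; ring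

theorem mul (hf : HasRightExpansion f p) (hg : HasRightExpansion g q) :
    HasRightExpansion (fun r => f r * g r) (p * q) := by
  refine of_polynomial fun N => ⟨trunc N p * trunc N q, fun i hi => ?_, ?_⟩
  · rw [coeff_mul_eq_coeff_trunc_mul_trunc p q hi, ← Polynomial.coeff_coe, Polynomial.coe_mul]
  · have hP : (fun r : ℝ => (trunc N p).eval r) =O[𝓝[>] 0] (fun _ : ℝ => (1 : ℝ)) :=
      ((trunc N p).continuous.tendsto 0).isBigO_one ℝ |>.mono nhdsWithin_le_nhds
    have h1 := (hf N).mul hg.isBigO_one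
    have h2 := hP.mul (hg N)
    simp only [← eval_trunc, mul_one, one_mul] at h1 h2
    refine (h1.add h2).congr_left fun r => ?_
    simp only [Polynomial.eval_mul]
    ring

theorem const_mul (c : ℝ) (hf : HasRightExpansion f p) :
    HasRightExpansion (fun r => c * f r) (C c * p) := (const c).mul hf

theorem pow (hf : HasRightExpansion f p) (n : ℕ) :
    HasRightExpansion (fun r => f r ^ n) (p ^ n) := by
  induction n with
  | zero => simpa using const 1
  | succ n ih => simpa [pow_succ] using ih.mul hf

theorem sub (hf : HasRightExpansion f p) (hg : HasRightExpansion g q) :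
    HasRightExpansion (fun r => f r - g r) (p - q) := by
  have := hf.add (hg.const_mul (-1))
  simpa [sub_eq_add_neg] using this

theorem sum {ι : Type*} (s : Finset ι) {f : ι → ℝ → ℝ} {p : ι → PowerSeries ℝ}
    (h : ∀ i ∈ s, HasRightExpansion (f i) (p i)) :
    HasRightExpansion (fun r => ∑ i ∈ s, f i r) (∑ i ∈ s, p i) := by
  classical
  induction s using Finset.induction_on with
  | empty => simpa using const 0
  | insert a s ha ih =>
    simp only [Finset.sum_insert ha]
    exact (h a (by simp)).add (ih fun i hi => h i (by simp [hi]))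

theorem tendsto (hf : HasRightExpansion f p) : Tendsto f (𝓝[>] 0) (𝓝 (constantCoeff p)) := by
  have h1 := hf 1
  have h2 : Tendsto (fun r : ℝ => r ^ 1) (𝓝[>] 0) (𝓝 0) := by
    simp only [pow_one]
    exact (tendsto_id (α := ℝ) (x := 𝓝 0)).mono_left nhdsWithin_le_nhds
  have h3 := h1.trans_tendsto h2
  have h4 := h3.add_const (constantCoeff p)
  simpa using h4

theorem eq_zero (hp : HasRightExpansion (fun _ => 0) p) : p = 0 := by
  ext d
  induction d using Nat.strong_induction_on with
  | _ d ih =>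
    have h := hp (d + 1)
    rw [map_zero]
    have h1 : (fun r : ℝ => coeff d p * r ^ d) =O[𝓝[>] 0] (fun r : ℝ => r * r ^ d) := by
      rw [← isBigO_neg_left]
      refine h.congr (fun r => ?_) (fun r => by ring)
      rw [Finset.sum_range_succ, Finset.sum_eq_zero]
      · ring
      · intro i hi
        simp [ih i (Finset.mem_range.1 hi)]
    have h2 : (fun _ : ℝ => coeff d p) =O[𝓝[>] 0] (fun r : ℝ => r) := by
      have h3 := h1.mul (isBigO_refl (fun r : ℝ => (r ^ d)⁻¹) (𝓝[>] 0))
      refine h3.congr' ?_ ?_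
      · filter_upwards [self_mem_nhdsWithin] with r hr
        have : r ≠ 0 := ne_of_gt hr
        field_simp
      · filter_upwards [self_mem_nhdsWithin] with r hr
        have : r ≠ 0 := ne_of_gt hr
        field_simp
    have h3 : Tendsto (fun r : ℝ => r) (𝓝[>] 0) (𝓝 0) :=
      (tendsto_id (α := ℝ) (x := 𝓝 0)).mono_left nhdsWithin_le_nhds
    exact tendsto_nhds_unique tendsto_const_nhds (h2.trans_tendsto h3)

theorem unique (hp : HasRightExpansion f p) (hq : HasRightExpansion f q) : p = q := by
  have := hp.sub hq
  simp only [sub_self] at this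
  exact sub_eq_zero.1 this.eq_zero

/-- With `q_N` the truncation of `q`, `1/f - q_N = (1/f)(1 - f q_N)`; here `1/f` is bounded and `p
q_N ≡ 1` modulo `X^N`. -/
theorem inv (hf : HasRightExpansion f p) (hpq : p * q = 1) :
    HasRightExpansion (fun r => (f r)⁻¹) q := by
  have h0 : constantCoeff p ≠ 0 := by
    intro h
    have := congrArg constantCoeff hpq
    simp [h] at this
  have ht := hf.tendsto
  have hne : ∀ᶠ r in 𝓝[>] 0, f r ≠ 0 := ht.eventually_ne h0
  have hinv : (fun r => (f r)⁻¹) =O[𝓝[>] 0] (fun _ : ℝ => (1 : ℝ)) := (ht.inv₀ h0).isBigO_one ℝ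
  refine of_polynomial fun N => ⟨trunc N q, fun i hi => by simp [coeff_trunc, hi], ?_⟩
  have hq : HasRightExpansion (fun r => (trunc N q).eval r) (trunc N q : PowerSeries ℝ) :=
    of_eval _
  have h1 := (hf.mul hq) N
  have h2 : (fun r => 1 - f r * (trunc N q).eval r) =O[𝓝[>] 0] (fun r : ℝ => r ^ N) := by
    have h3 : ∀ r : ℝ, ∑ i ∈ Finset.range N, coeff i (p * (trunc N q : PowerSeries ℝ)) * r ^ i =
        ∑ i ∈ Finset.range N, coeff i (1 : PowerSeries ℝ) * r ^ i := by
      intro r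
      refine Finset.sum_congr rfl fun i hi => ?_
      have hi := Finset.mem_range.1 hi
      rw [← hpq, coeff_mul_eq_coeff_trunc_mul_trunc p q hi,
        coeff_mul_eq_coeff_trunc_mul_trunc p _ hi, trunc_trunc]
    have h4 := const 1 N
    refine (h4.sub h1).congr_left fun r => ?_
    rw [h3]; simp
  refine (hinv.mul h2).congr' ?_ (by simp)
  filter_upwards [hne] with r hr
  field_simp

/-- The exponential of a formal power series; it is the usual one when the constant coefficient
vanishes. -/
noncomputable def expComp {R : Type*} [CommRing R] [Algebra ℚ R] (p : PowerSeries R) :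
    PowerSeries R :=
  PowerSeries.mk fun n => ∑ i ∈ Finset.range (n + 1),
    algebraMap ℚ R (1 / (i.factorial : ℚ)) * coeff n (p ^ i)

theorem exp (hf : HasRightExpansion f p) (h0 : constantCoeff p = 0) :
    HasRightExpansion (fun r => Real.exp (f r)) (expComp p) := by
  have hlim : Tendsto f (𝓝[>] 0) (𝓝 0) := by simpa [h0] using hf.tendsto
  have hO : f =O[𝓝[>] 0] (fun r : ℝ => r) := by simpa [h0] using hf 1
  refine of_polynomial fun N => ?_
  have hs : HasRightExpansion (fun r => ∑ i ∈ Finset.range N, (1 / (i.factorial : ℝ)) * f r ^ i)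
      (∑ i ∈ Finset.range N, C (1 / (i.factorial : ℝ)) * p ^ i) :=
    sum _ fun i _ => (hf.pow i).const_mul _
  refine ⟨trunc N (∑ i ∈ Finset.range N, C (1 / (i.factorial : ℝ)) * p ^ i), fun n hn => ?_, ?_⟩
  · rw [coeff_trunc, if_pos hn]
    simp only [expComp, coeff_mk, map_sum, coeff_C_mul]
    symm
    -- For `i > n` the power `p^i` has order at least `i`, so it does not reach degree `n`.
    apply Finset.sum_subset_zero_on_sdiff
    · exact Finset.range_subset_range.2 hn
    · intro i hi
      simp only [Finset.mem_sdiff, Finset.mem_range, not_lt] at hi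
      rw [coeff_of_lt_order, mul_zero]
      have h1 : (1 : ℕ∞) ≤ p.order := by
        rw [← Nat.cast_one]; apply nat_le_order
        intro j hj
        obtain rfl : j = 0 := by omega
        simpa using h0
      calc (n : ℕ∞) < i := by exact_mod_cast (by omega : n < i)
        _ = i • (1 : ℕ∞) := by simp
        _ ≤ i • p.order := nsmul_le_nsmul_right h1 i
        _ ≤ _ := le_order_pow _ _
    · intro i _
      simp
  · have h1 : (fun r => Real.exp (f r) - ∑ i ∈ Finset.range N, f r ^ i / i.factorial) =O[𝓝[>] 0]
        (fun r : ℝ => r ^ N) :=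
      ((Real.exp_sub_sum_range_isBigO_pow N).comp_tendsto hlim).trans (hO.pow N)
    refine (h1.add (hs N)).congr_left fun r => ?_
    rw [eval_trunc]
    simp only [one_div, inv_mul_eq_div]
    ring

end HasRightExpansion

/-! ### Expansion of integrals against powers of `log (1 + exp (-t))` -/

section

theorem Real.abs_exp_sub_sum_le (x : ℝ) (N : ℕ) :
    |Real.exp x - ∑ k ∈ Finset.range N, x ^ k / k.factorial| ≤ |x| ^ N * Real.exp |x| := by
  have h := Complex.norm_exp_sub_sum_le_norm_mul_exp (x : ℂ) N
  rw [Complex.norm_real, Real.norm_eq_abs] at h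
  rw [← Real.norm_eq_abs, ← Complex.norm_real]
  push_cast
  exact h

/-- The function `log (1 + exp (-t))`. -/
noncomputable def logOneAddExpNeg (t : ℝ) : ℝ := Real.log (1 + Real.exp (-t))

theorem continuous_logOneAddExpNeg : Continuous logOneAddExpNeg :=
  Continuous.log (by fun_prop) fun t => by positivity

theorem exp_logOneAddExpNeg (t : ℝ) : Real.exp (logOneAddExpNeg t) = 1 + Real.exp (-t) :=
  Real.exp_log (by positivity)

theorem logOneAddExpNeg_nonneg (t : ℝ) : 0 ≤ logOneAddExpNeg t :=
  Real.log_nonneg (by linarith [Real.exp_pos (-t)])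

theorem logOneAddExpNeg_le (t : ℝ) : logOneAddExpNeg t ≤ Real.exp (-t) := by
  have := Real.log_le_sub_one_of_pos (x := 1 + Real.exp (-t)) (by positivity)
  unfold logOneAddExpNeg
  linarith

theorem logOneAddExpNeg_le_one {t : ℝ} (ht : 0 < t) : logOneAddExpNeg t ≤ 1 :=
  (logOneAddExpNeg_le t).trans (Real.exp_le_one_iff.2 (by linarith))

open MeasureTheory Set

theorem integrableOn_pow_mul_exp_neg (m : ℕ) :
    IntegrableOn (fun t : ℝ => t ^ m * Real.exp (-t)) (Ioi 0) := by
  have h := Real.GammaIntegral_convergent (s := m + 1) (by positivity)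
  refine h.congr_fun (fun t _ => ?_) measurableSet_Ioi
  simp [mul_comm]

/-- One factor `l ≤ e^(-t)` suffices for decay, the others being at most 1. For `k = 0` there is no
decay, hence the `-1` in the integrals below. -/
theorem integrableOn_pow_mul_logOneAddExpNeg_pow (m : ℕ) {k : ℕ} (hk : k ≠ 0) :
    IntegrableOn (fun t : ℝ => t ^ m * logOneAddExpNeg t ^ k) (Ioi 0) := by
  refine (integrableOn_pow_mul_exp_neg m).mono'
    ((continuous_pow m).mul (continuous_logOneAddExpNeg.pow k)).aestronglyMeasurable ?_
  refine (ae_restrict_iff' measurableSet_Ioi).2 (ae_of_all _ fun t (ht : 0 < t) => ?_)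
  have h0 := logOneAddExpNeg_nonneg t
  rw [Real.norm_eq_abs, abs_of_nonneg (by positivity)]
  gcongr
  exact (pow_le_of_le_one h0 (logOneAddExpNeg_le_one ht) hk).trans (logOneAddExpNeg_le t)

/-- The moment `∫₀^∞ tᵐ log(1 + e⁻ᵗ)ᵏ dt`. -/
noncomputable def logMoment (k m : ℕ) : ℝ := ∫ t in Ioi (0 : ℝ), t ^ m * logOneAddExpNeg t ^ k

/-- The weights `aᵏ / k!` for `k ≥ 1`, with the weight for `k = 0` removed. -/
noncomputable def expSubOneCoeff (a : ℝ) (k : ℕ) : ℝ := if k = 0 then 0 else a ^ k / k.factorial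

/-- The coefficient of degree `d` in the expansion of
`∫₀^∞ ((1 + e⁻ᵗ)^(a r) - 1) φ(r t) dt`, where `p` is the expansion of `φ`. -/
noncomputable def momentCoeff (a : ℝ) (p : PowerSeries ℝ) (d : ℕ) : ℝ :=
  ∑ x ∈ Finset.HasAntidiagonal.antidiagonal d,
    expSubOneCoeff a x.1 * PowerSeries.coeff x.2 p * logMoment x.1 x.2

open Topology in
-- In `φ(rt)` the argument runs over all of `(0,∞)`, so a bound near 0 is not enough. Beyond `ε`
-- boundedness takes over: `s^i ≤ s^N / ε^(N-i)` there.
theorem HasRightExpansion.exists_global_bound {φ : ℝ → ℝ} {p : PowerSeries ℝ}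
    (h : HasRightExpansion φ p) {B : ℝ} (hB : ∀ s > 0, |φ s| ≤ B) (N : ℕ) :
    ∃ C, 0 ≤ C ∧ ∀ s > 0,
      |φ s - ∑ i ∈ Finset.range N, PowerSeries.coeff i p * s ^ i| ≤ C * s ^ N := by
  obtain ⟨c, hc, hO⟩ := (h N).exists_nonneg
  rw [isBigOWith_iff] at hO
  obtain ⟨ε, hε, hs⟩ := mem_nhdsGT_iff_exists_Ioo_subset.1 hO
  have hε : 0 < ε := hε
  have hB0 : 0 ≤ B := (abs_nonneg _).trans (hB 1 one_pos)
  refine ⟨c + (B / ε ^ N + ∑ i ∈ Finset.range N, |PowerSeries.coeff i p| / ε ^ (N - i)),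
    by positivity, fun s hs0 => ?_⟩
  have hpos : 0 ≤ B / ε ^ N + ∑ i ∈ Finset.range N, |PowerSeries.coeff i p| / ε ^ (N - i) := by
    positivity
  rcases lt_or_ge s ε with hsε | hsε
  · have h1 : ‖_‖ ≤ c * ‖s ^ N‖ := hs ⟨hs0, hsε⟩
    rw [Real.norm_eq_abs, Real.norm_eq_abs, abs_of_pos (pow_pos hs0 N)] at h1
    refine h1.trans ?_
    gcongr
    linarith
  · have key : ∀ i ≤ N, s ^ i ≤ s ^ N / ε ^ (N - i) := by
      intro i hi
      rw [le_div_iff₀ (by positivity)]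
      calc s ^ i * ε ^ (N - i) ≤ s ^ i * s ^ (N - i) := by gcongr
        _ = s ^ N := by rw [← pow_add]; congr 1; omega
    calc |φ s - ∑ i ∈ Finset.range N, PowerSeries.coeff i p * s ^ i|
        ≤ |φ s| + |∑ i ∈ Finset.range N, PowerSeries.coeff i p * s ^ i| := abs_sub _ _
      _ ≤ B * 1 + ∑ i ∈ Finset.range N, |PowerSeries.coeff i p| * s ^ i := by
          gcongr
          · simpa using hB s hs0
          · refine (Finset.abs_sum_le_sum_abs _ _).trans (le_of_eq ?_)
            refine Finset.sum_congr rfl fun i _ => ?_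
            rw [abs_mul, abs_of_pos (pow_pos hs0 i)]
      _ ≤ B * (s ^ N / ε ^ N) +
          ∑ i ∈ Finset.range N, |PowerSeries.coeff i p| * (s ^ N / ε ^ (N - i)) := by
          gcongr with i hi
          · simpa using key 0 (Nat.zero_le _)
          · exact key i (Finset.mem_range.1 hi).le
      _ = (B / ε ^ N + ∑ i ∈ Finset.range N, |PowerSeries.coeff i p| / ε ^ (N - i)) * s ^ N := by
          rw [add_mul, Finset.sum_mul]
          congr 1
          · ring
          · exact Finset.sum_congr rfl fun i _ => by ring
      _ ≤ _ := mul_le_mul_of_nonneg_right (le_add_of_nonneg_left hc) (pow_nonneg hs0.le N)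

theorem coeff_sum_sum_monomial (c : ℕ → ℕ → ℝ) {i N : ℕ} (hi : i < N) :
    (∑ k ∈ Finset.range N, ∑ m ∈ Finset.range N, Polynomial.monomial (k + m) (c k m)).coeff i =
      ∑ x ∈ Finset.HasAntidiagonal.antidiagonal i, c x.1 x.2 := by
  simp only [Polynomial.finsetSum_coeff, Polynomial.coeff_monomial]
  rw [← Finset.sum_product', ← Finset.sum_filter]
  refine Finset.sum_congr ?_ fun _ _ => rfl
  ext ⟨k, m⟩
  simp only [Finset.mem_filter, Finset.mem_product, Finset.mem_range,
    Finset.HasAntidiagonal.mem_antidiagonal]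
  omega

/-- Replace each factor by its truncation. Both resulting errors keep a factor `l` and yield `r^N`,
so the majorant is integrable in `t` with a constant independent of `r`. -/
theorem abs_exp_sub_one_mul_sub_le {a B C r t : ℝ} {φ : ℝ → ℝ} {p : PowerSeries ℝ} {N : ℕ}
    (hN : N ≠ 0) (hr : 0 < r) (hr1 : r ≤ 1) (ht : 0 < t) (hB : ∀ s > 0, |φ s| ≤ B)
    (hC : ∀ s > 0, |φ s - ∑ i ∈ Finset.range N, PowerSeries.coeff i p * s ^ i| ≤ C * s ^ N) :
    |(Real.exp (a * r * logOneAddExpNeg t) - 1) * φ (r * t) -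
      ∑ k ∈ Finset.range N, ∑ m ∈ Finset.range N, r ^ (k + m) *
        (expSubOneCoeff a k * PowerSeries.coeff m p) * (t ^ m * logOneAddExpNeg t ^ k)| ≤
    ((|a| ^ N * Real.exp |a| * B) * (t ^ 0 * logOneAddExpNeg t ^ 1) +
      ((∑ k ∈ Finset.range N, |expSubOneCoeff a k|) * C) * (t ^ N * logOneAddExpNeg t ^ 1))
      * r ^ N := by
  set l := logOneAddExpNeg t with hl
  have l0 : 0 ≤ l := logOneAddExpNeg_nonneg t
  have l1 : l ≤ 1 := logOneAddExpNeg_le_one ht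
  have hB0 : 0 ≤ B := (abs_nonneg _).trans (hB 1 one_pos)
  set u := ∑ k ∈ Finset.range N, expSubOneCoeff a k * l ^ k * r ^ k with hu
  set v := ∑ m ∈ Finset.range N, PowerSeries.coeff m p * (r * t) ^ m with hv
  have huv : ∑ k ∈ Finset.range N, ∑ m ∈ Finset.range N, r ^ (k + m) *
        (expSubOneCoeff a k * PowerSeries.coeff m p) * (t ^ m * l ^ k) = u * v := by
    rw [hu, hv, Finset.sum_mul_sum]
    exact Finset.sum_congr rfl fun k _ => Finset.sum_congr rfl fun m _ => by ring
  have hu' : ∑ k ∈ Finset.range N, (a * r * l) ^ k / k.factorial = 1 + u := by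
    obtain ⟨M, rfl⟩ := Nat.exists_eq_succ_of_ne_zero hN
    rw [hu, Finset.sum_range_succ', Finset.sum_range_succ']
    simp only [expSubOneCoeff]
    simp
    rw [add_comm]
    congr 1
    exact Finset.sum_congr rfl fun k _ => by ring
  have hE : |Real.exp (a * r * l) - 1 - u| ≤ |a| ^ N * Real.exp |a| * l * r ^ N := by
    have h1 := Real.abs_exp_sub_sum_le (a * r * l) N
    rw [hu', ← sub_sub] at h1
    refine h1.trans ?_
    have hx : |a * r * l| = |a| * r * l := by
      rw [abs_mul, abs_mul, abs_of_pos hr, abs_of_nonneg l0]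
    have hx1 : |a| * r * l ≤ |a| := by
      have : r * l ≤ 1 := mul_le_one₀ hr1 l0 l1
      nlinarith [abs_nonneg a]
    rw [hx]
    calc (|a| * r * l) ^ N * Real.exp (|a| * r * l)
        = |a| ^ N * Real.exp (|a| * r * l) * l ^ N * r ^ N := by ring
      _ ≤ |a| ^ N * Real.exp |a| * l * r ^ N := by
        gcongr
        exact pow_le_of_le_one l0 l1 hN
  have hU : |u| ≤ (∑ k ∈ Finset.range N, |expSubOneCoeff a k|) * l := by
    rw [hu, Finset.sum_mul]
    refine (Finset.abs_sum_le_sum_abs _ _).trans (Finset.sum_le_sum fun k _ => ?_)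
    rcases eq_or_ne k 0 with rfl | hk
    · simp [expSubOneCoeff]
    · rw [mul_assoc, abs_mul]
      gcongr
      rw [abs_of_nonneg (by positivity)]
      calc l ^ k * r ^ k ≤ l * 1 := by
            gcongr
            · exact pow_le_of_le_one l0 l1 hk
            · exact pow_le_one₀ hr.le hr1
        _ = l := mul_one l
  have hP := hC (r * t) (mul_pos hr ht)
  rw [huv]
  calc |(Real.exp (a * r * l) - 1) * φ (r * t) - u * v|
      = |(Real.exp (a * r * l) - 1 - u) * φ (r * t) + u * (φ (r * t) - v)| := by
        congr 1; ring
    _ ≤ |Real.exp (a * r * l) - 1 - u| * |φ (r * t)| + |u| * |φ (r * t) - v| := by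
        rw [← abs_mul, ← abs_mul]; exact abs_add_le _ _
    _ ≤ (|a| ^ N * Real.exp |a| * l * r ^ N) * B +
        ((∑ k ∈ Finset.range N, |expSubOneCoeff a k|) * l) * (C * (r * t) ^ N) := by
        gcongr
        exact hB _ (mul_pos hr ht)
    _ = _ := by ring

open Topology in
theorem hasRightExpansion_integral_exp_sub_one (a : ℝ) {φ : ℝ → ℝ} {p : PowerSeries ℝ}
    (hφ : Continuous φ) (hp : HasRightExpansion φ p) {B : ℝ} (hB : ∀ s > 0, |φ s| ≤ B) :
    HasRightExpansion
      (fun r => ∫ t in Ioi (0 : ℝ), (Real.exp (a * r * logOneAddExpNeg t) - 1) * φ (r * t))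
      (PowerSeries.mk (momentCoeff a p)) := by
  refine HasRightExpansion.of_polynomial fun N' => ?_
  -- A positive order is needed for the remainder of the exponential to contain a factor `l`.
  obtain ⟨N, hNN, hN⟩ : ∃ N, N' ≤ N ∧ N ≠ 0 := ⟨N' + 1, by omega, by omega⟩
  obtain ⟨C, hC0, hC⟩ := hp.exists_global_bound hB N
  refine ⟨∑ k ∈ Finset.range N, ∑ m ∈ Finset.range N, Polynomial.monomial (k + m)
    (expSubOneCoeff a k * PowerSeries.coeff m p * logMoment k m), fun i hi => ?_, ?_⟩
  · rw [coeff_sum_sum_monomial (fun k m => expSubOneCoeff a k * PowerSeries.coeff m p *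
      logMoment k m) (hi.trans_le hNN), PowerSeries.coeff_mk, momentCoeff]
  · refine IsBigO.trans ?_ (isBigO_pow_pow_nhdsGT hNN)
    set G : ℝ → ℝ := fun t => (|a| ^ N * Real.exp |a| * B) * (t ^ 0 * logOneAddExpNeg t ^ 1) +
      ((∑ k ∈ Finset.range N, |expSubOneCoeff a k|) * C) * (t ^ N * logOneAddExpNeg t ^ 1) with hG
    have hGi : IntegrableOn G (Ioi 0) :=
      ((integrableOn_pow_mul_logOneAddExpNeg_pow 0 one_ne_zero).const_mul _).add
        ((integrableOn_pow_mul_logOneAddExpNeg_pow N one_ne_zero).const_mul _)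
    refine IsBigO.of_bound (∫ t in Ioi (0 : ℝ), G t) ?_
    filter_upwards [Ioo_mem_nhdsGT (zero_lt_one' ℝ)] with r hr
    set S : ℝ → ℝ := fun t => ∑ k ∈ Finset.range N, ∑ m ∈ Finset.range N, r ^ (k + m) *
        (expSubOneCoeff a k * PowerSeries.coeff m p) * (t ^ m * logOneAddExpNeg t ^ k) with hS
    set F : ℝ → ℝ := fun t => (Real.exp (a * r * logOneAddExpNeg t) - 1) * φ (r * t) with hF
    have hterm : ∀ k m : ℕ, IntegrableOn (fun t : ℝ => r ^ (k + m) *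
        (expSubOneCoeff a k * PowerSeries.coeff m p) * (t ^ m * logOneAddExpNeg t ^ k))
        (Ioi 0) := by
      intro k m
      rcases eq_or_ne k 0 with rfl | hk
      · simp [expSubOneCoeff]
      · exact (integrableOn_pow_mul_logOneAddExpNeg_pow m hk).const_mul _
    have hSi : IntegrableOn S (Ioi 0) :=
      integrable_finsetSum _ fun k _ => integrable_finsetSum _ fun m _ => hterm k m
    have hSint : ∫ t in Ioi (0 : ℝ), S t = (∑ k ∈ Finset.range N, ∑ m ∈ Finset.range N,
        Polynomial.monomial (k + m)
          (expSubOneCoeff a k * PowerSeries.coeff m p * logMoment k m)).eval r := by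
      rw [hS, integral_finsetSum _ fun k _ => integrable_finsetSum _ fun m _ => hterm k m]
      simp only [Polynomial.eval_finsetSum, Polynomial.eval_monomial]
      refine Finset.sum_congr rfl fun k _ => ?_
      rw [integral_finsetSum _ fun m _ => hterm k m]
      refine Finset.sum_congr rfl fun m _ => ?_
      rw [integral_const_mul, logMoment]
      ring
    have hbd : ∀ᵐ t ∂volume.restrict (Ioi (0 : ℝ)), ‖F t - S t‖ ≤ G t * r ^ N :=
      (ae_restrict_iff' measurableSet_Ioi).2 (ae_of_all _ fun t (ht : 0 < t) =>
        abs_exp_sub_one_mul_sub_le hN hr.1 hr.2.le ht hB hC)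
    have hl := continuous_logOneAddExpNeg
    have hFS : IntegrableOn (fun t => F t - S t) (Ioi 0) := by
      refine (hGi.mul_const (r ^ N)).mono' (Continuous.aestronglyMeasurable ?_) hbd
      fun_prop
    have hFi : IntegrableOn F (Ioi 0) := by
      refine (hFS.add hSi).congr (ae_of_all _ fun t => ?_)
      simp
    rw [← hSint, ← integral_sub hFi hSi, Real.norm_of_nonneg (pow_nonneg hr.1.le N),
      ← integral_mul_const]
    exact norm_integral_le_of_norm_le (hGi.mul_const _) hbd

end

/-! ### The logarithm of the Beta function and zeta values -/

theorem Real.abs_log_one_add_sub_le {x : ℝ} (h0 : 0 ≤ x) (h : x ≤ 1 / 2) (N : ℕ) :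
    |Real.log (1 + x) - ∑ k ∈ Finset.range N, (-1) ^ k * x ^ (k + 1) / (k + 1)| ≤
      2 * x ^ (N + 1) := by
  have h1 := Real.abs_log_sub_add_sum_range_le (x := -x)
    (by rw [abs_neg, abs_of_nonneg h0]; linarith) N
  rw [abs_neg, abs_of_nonneg h0, sub_neg_eq_add, add_comm] at h1
  have h2 : ∑ k ∈ Finset.range N, (-x) ^ (k + 1) / ((k : ℝ) + 1) =
      - ∑ k ∈ Finset.range N, (-1) ^ k * x ^ (k + 1) / ((k : ℝ) + 1) := by
    rw [← Finset.sum_neg_distrib]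
    refine Finset.sum_congr rfl fun k _ => ?_
    rw [neg_pow]; ring
  rw [h2, ← sub_eq_add_neg] at h1
  refine h1.trans ?_
  rw [div_le_iff₀ (by linarith)]
  nlinarith [pow_nonneg h0 (N + 1)]

/-- The summand `log (1 + x) - log (1 + b x) - log (1 + c x)` in the logarithm of the product
formula for the Beta function. -/
noncomputable def logBetaTerm (b c x : ℝ) : ℝ :=
  Real.log (1 + x) - Real.log (1 + b * x) - Real.log (1 + c * x)

theorem abs_logBetaTerm_sub_le {b c x : ℝ} (hb : 0 < b) (hc : 0 < c) (hbc : b + c = 1)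
    (h0 : 0 ≤ x) (h : x ≤ 1 / 2) (N : ℕ) :
    |logBetaTerm b c x - ∑ k ∈ Finset.range N,
      (-1) ^ k / (k + 1) * (1 - b ^ (k + 1) - c ^ (k + 1)) * x ^ (k + 1)| ≤ 6 * x ^ (N + 1) := by
  have e1 := Real.abs_log_one_add_sub_le h0 h N
  have e2 := Real.abs_log_one_add_sub_le (x := b * x) (by positivity) (by nlinarith) N
  have e3 := Real.abs_log_one_add_sub_le (x := c * x) (by positivity) (by nlinarith) N
  have b1 : (b * x) ^ (N + 1) ≤ x ^ (N + 1) := by gcongr; nlinarith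
  have c1 : (c * x) ^ (N + 1) ≤ x ^ (N + 1) := by gcongr; nlinarith
  have hs : ∑ k ∈ Finset.range N,
      (-1) ^ k / ((k : ℝ) + 1) * (1 - b ^ (k + 1) - c ^ (k + 1)) * x ^ (k + 1) =
      ∑ k ∈ Finset.range N, (-1) ^ k * x ^ (k + 1) / ((k : ℝ) + 1) -
      ∑ k ∈ Finset.range N, (-1) ^ k * (b * x) ^ (k + 1) / ((k : ℝ) + 1) -
      ∑ k ∈ Finset.range N, (-1) ^ k * (c * x) ^ (k + 1) / ((k : ℝ) + 1) := by
    rw [← Finset.sum_sub_distrib, ← Finset.sum_sub_distrib]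
    refine Finset.sum_congr rfl fun k _ => ?_
    rw [mul_pow, mul_pow]; ring
  rw [hs, logBetaTerm]
  rw [abs_le] at *
  constructor <;> linarith

theorem summable_one_div_succ_pow {k : ℕ} (hk : 1 < k) :
    Summable (fun m : ℕ => 1 / ((m : ℝ) + 1) ^ k) := by
  have := (summable_nat_add_iff 1).2 (Real.summable_one_div_nat_pow.2 hk)
  simpa using this

/-- The zeta value `ζ(k)` as a real number. -/
noncomputable def realZeta (k : ℕ) : ℝ := ∑' m : ℕ, 1 / ((m : ℝ) + 1) ^ k

theorem ofReal_realZeta {k : ℕ} (hk : 1 < k) : ((realZeta k : ℝ) : ℂ) = riemannZeta k := by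
  have h := Complex.hasSum_ofReal.2 (Real.summable_one_div_nat_pow.2 hk).hasSum
  rw [zeta_nat_eq_tsum_of_gt_one hk, realZeta, Complex.ofReal_tsum]
  have h2 : Summable (fun n : ℕ => 1 / (n : ℂ) ^ k) := by
    refine h.summable.congr fun n => by simp
  rw [h2.tsum_eq_zero_add]
  have : k ≠ 0 := by omega
  simp [this]

/-- The coefficients of the expansion of `log (r b c B(r b, r c))`. -/
noncomputable def logBetaCoeff (b c : ℝ) (k : ℕ) : ℝ :=
  if k < 2 then 0 else (-1) ^ (k - 1) / k * (1 - b ^ k - c ^ k) * realZeta k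

theorem summable_logBetaTerm {b c r : ℝ} (hb : 0 < b) (hc : 0 < c) (hbc : b + c = 1)
    (h0 : 0 ≤ r) (h : r ≤ 1 / 2) :
    Summable (fun m : ℕ => logBetaTerm b c (r / (m + 1))) := by
  refine Summable.of_norm_bounded (g := fun m : ℕ => 6 * r ^ 2 * (1 / ((m : ℝ) + 1) ^ 2))
    ((summable_one_div_succ_pow one_lt_two).mul_left _) fun m => ?_
  have hx : r / ((m : ℝ) + 1) ≤ 1 / 2 :=
    (div_le_self h0 (by linarith [m.cast_nonneg (α := ℝ)])).trans h
  have := abs_logBetaTerm_sub_le hb hc hbc (by positivity : 0 ≤ r / ((m : ℝ) + 1)) hx 1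
  rw [Real.norm_eq_abs]
  simp only [Finset.range_one, Finset.sum_singleton, zero_add, pow_one] at this
  -- The linear term drops out because `b + c = 1`; this gives convergence and keeps Euler's
  -- constant out of the expansion.
  rw [show (1 - b - c : ℝ) = 0 by linarith] at this
  simp only [mul_zero, zero_mul, sub_zero] at this
  refine this.trans (le_of_eq ?_)
  rw [div_pow]; ring

open Topology in
theorem hasRightExpansion_tsum_logBetaTerm {b c : ℝ} (hb : 0 < b) (hc : 0 < c) (hbc : b + c = 1) :
    HasRightExpansion (fun r => ∑' m : ℕ, logBetaTerm b c (r / (m + 1)))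
      (PowerSeries.mk (logBetaCoeff b c)) := by
  refine HasRightExpansion.of_ge fun N' => ?_
  -- With order at least 2 the error sum `∑ 1/(m+1)^(N+1)` converges.
  refine ⟨N' + 2, by omega, ?_⟩
  set N := N' + 1 with hN
  refine IsBigO.of_bound (6 * realZeta (N + 1)) ?_
  filter_upwards [Ioo_mem_nhdsGT (by norm_num : (0 : ℝ) < 1 / 2)] with r hr
  have hr0 := hr.1.le
  have hz : ∀ k < N, Summable fun m : ℕ => (-1) ^ k / ((k : ℝ) + 1) *
      (1 - b ^ (k + 1) - c ^ (k + 1)) * (r / ((m : ℝ) + 1)) ^ (k + 1) := by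
    intro k _
    rcases eq_or_ne k 0 with rfl | hk
    · simp only [zero_add, pow_one]
      rw [show (1 - b - c : ℝ) = 0 by linarith]
      simp
    · simp only [div_pow, div_eq_mul_one_div (r ^ (k + 1))]
      exact ((summable_one_div_succ_pow (by omega)).mul_left _).mul_left _
  have hpoly : ∑ i ∈ Finset.range (N + 1), PowerSeries.coeff i (PowerSeries.mk (logBetaCoeff b c)) *
      r ^ i = ∑' m : ℕ, ∑ k ∈ Finset.range N, (-1) ^ k / ((k : ℝ) + 1) *
      (1 - b ^ (k + 1) - c ^ (k + 1)) * (r / ((m : ℝ) + 1)) ^ (k + 1) := by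
    rw [Summable.tsum_finsetSum fun k hk => hz k (Finset.mem_range.1 hk), Finset.sum_range_succ']
    simp only [PowerSeries.coeff_mk]
    rw [show logBetaCoeff b c 0 = 0 by simp [logBetaCoeff], zero_mul, add_zero]
    refine Finset.sum_congr rfl fun k _ => ?_
    rcases eq_or_ne k 0 with rfl | hk
    · simp only [zero_add, pow_one]
      rw [show (1 - b - c : ℝ) = 0 by linarith]
      simp [logBetaCoeff]
    · simp only [div_pow, div_eq_mul_one_div (r ^ (k + 1))]
      rw [tsum_mul_left, tsum_mul_left, logBetaCoeff, if_neg (by omega), realZeta]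
      push_cast
      ring
  have hfin : Summable fun m : ℕ => ∑ k ∈ Finset.range N, (-1) ^ k / ((k : ℝ) + 1) *
      (1 - b ^ (k + 1) - c ^ (k + 1)) * (r / ((m : ℝ) + 1)) ^ (k + 1) :=
    summable_sum fun k hk => hz k (Finset.mem_range.1 hk)
  have hbd : ∀ m : ℕ, ‖logBetaTerm b c (r / ((m : ℝ) + 1)) -
      ∑ k ∈ Finset.range N, (-1) ^ k / ((k : ℝ) + 1) *
      (1 - b ^ (k + 1) - c ^ (k + 1)) * (r / ((m : ℝ) + 1)) ^ (k + 1)‖ ≤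
      6 * r ^ (N + 1) * (1 / ((m : ℝ) + 1) ^ (N + 1)) := by
    intro m
    have hx : r / ((m : ℝ) + 1) ≤ 1 / 2 :=
      (div_le_self hr0 (by linarith [m.cast_nonneg (α := ℝ)])).trans hr.2.le
    refine (abs_logBetaTerm_sub_le hb hc hbc (by positivity) hx N).trans (le_of_eq ?_)
    rw [div_pow]; ring
  rw [show N' + 2 = N + 1 from rfl, hpoly,
    ← (summable_logBetaTerm hb hc hbc hr0 hr.2.le).tsum_sub hfin,
    Real.norm_of_nonneg (pow_nonneg hr0 _)]
  refine (tsum_of_norm_bounded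
    (((summable_one_div_succ_pow (k := N + 1) (by omega)).hasSum).mul_left _) hbd).trans
    (le_of_eq ?_)
  rw [realZeta]; ring

open Topology Real.BohrMollerup in
-- Take the limit formula for each `log Γ`. The multiples of `log n` cancel because `b + c = 1`, and
-- `log (r b c)` cancels the factors of index 0.
theorem log_Gamma_eq_tsum_logBetaTerm {b c r : ℝ} (hb : 0 < b) (hc : 0 < c) (hbc : b + c = 1)
    (hr : 0 < r) (h : r ≤ 1 / 2) :
    Real.log (Real.Gamma (r * b)) + Real.log (Real.Gamma (r * c)) - Real.log (Real.Gamma r) +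
      Real.log (r * b * c) = ∑' m : ℕ, logBetaTerm b c (r / (m + 1)) := by
  have h1 := ((tendsto_log_gamma (mul_pos hr hb)).add
    (tendsto_log_gamma (mul_pos hr hc))).sub (tendsto_log_gamma hr)
  have h2 := h1.add_const (Real.log (r * b * c))
  refine tendsto_nhds_unique h2 ?_
  refine (summable_logBetaTerm hb hc hbc hr.le h).hasSum.tendsto_sum_nat.congr fun n => ?_
  have hfac : Real.log (n.factorial : ℝ) = ∑ m ∈ Finset.range n, Real.log ((m : ℝ) + 1) := by
    rw [← Real.log_prod (fun i _ => by positivity), ← Finset.prod_range_add_one_eq_factorial]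
    push_cast; rfl
  have hlog : ∀ z > 0, ∀ m : ℕ, Real.log (z * r + ((m + 1 : ℕ) : ℝ)) =
      Real.log ((m : ℝ) + 1) + Real.log (1 + z * (r / ((m : ℝ) + 1))) := by
    intro z hz m
    rw [← Real.log_mul (by positivity) (by positivity)]
    congr 1
    push_cast
    field_simp
    ring
  have hsum : ∀ z > 0, ∑ m ∈ Finset.range (n + 1), Real.log (z * r + m) =
      Real.log (n.factorial : ℝ) + ∑ m ∈ Finset.range n, Real.log (1 + z * (r / ((m : ℝ) + 1))) +
      Real.log z + Real.log r := by
    intro z hz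
    rw [Finset.sum_range_succ', Finset.sum_congr rfl fun m _ => hlog z hz m,
      Finset.sum_add_distrib, hfac, Nat.cast_zero, add_zero, Real.log_mul hz.ne' hr.ne']
    ring
  have s1 := hsum 1 one_pos
  simp only [one_mul, Real.log_one, add_zero] at s1
  simp only [logGammaSeq, logBetaTerm, Finset.sum_sub_distrib]
  rw [mul_comm r b, mul_comm r c, hsum b hb, hsum c hc, s1,
    mul_comm b r, Real.log_mul (by positivity) hc.ne',
    Real.log_mul hr.ne' hb.ne']
  have : (b + c) * r * Real.log n = r * Real.log n := by rw [hbc, one_mul]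
  linarith

/-! ### The logistic substitution -/

section

open MeasureTheory Set

theorem intervalIntegral_eq_integral_sigmoid (f : ℝ → ℝ) :
    ∫ x in (0 : ℝ)..1, f x =
      ∫ s : ℝ, Real.sigmoid s * (1 - Real.sigmoid s) * f (Real.sigmoid s) := by
  rw [intervalIntegral.integral_of_le zero_le_one, integral_Ioc_eq_integral_Ioo,
    ← Real.range_sigmoid, ← image_univ,
    integral_image_eq_integral_abs_deriv_smul MeasurableSet.univ
      (fun x _ => (Real.hasDerivAt_sigmoid x).hasDerivWithinAt) Real.sigmoid_injective.injOn,
    setIntegral_univ]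
  refine integral_congr_ae (ae_of_all _ fun s => ?_)
  have h1 := Real.sigmoid_pos s
  have h2 := Real.sigmoid_lt_one s
  simp only [smul_eq_mul]
  rw [abs_of_pos (mul_pos h1 (by linarith))]

theorem sigmoid_eq_exp (s : ℝ) : Real.sigmoid s = Real.exp (-logOneAddExpNeg s) := by
  rw [Real.exp_neg, exp_logOneAddExpNeg, Real.sigmoid_def]

theorem one_sub_sigmoid_eq_exp (s : ℝ) :
    1 - Real.sigmoid s = Real.exp (-logOneAddExpNeg s - s) := by
  rw [← Real.sigmoid_neg, ← Real.sigmoid_mul_rexp_neg, sigmoid_eq_exp, ← Real.exp_add,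
    sub_eq_add_neg]

theorem logOneAddExpNeg_neg (s : ℝ) : logOneAddExpNeg (-s) = logOneAddExpNeg s + s := by
  have h := one_sub_sigmoid_eq_exp s
  rw [← Real.sigmoid_neg, sigmoid_eq_exp, Real.exp_eq_exp] at h
  linarith

theorem integral_sigmoid_beta {u v : ℝ} (hu : 0 < u) (hv : 0 < v) :
    ∫ s : ℝ, Real.exp (-(u + v) * logOneAddExpNeg s - v * s) =
      Real.Gamma u * Real.Gamma v / Real.Gamma (u + v) := by
  have h := ProbabilityTheory.beta_eq_betaIntegralReal u v hu hv
  have h2 : Complex.betaIntegral u v =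
      ((∫ x in (0 : ℝ)..1, x ^ (u - 1) * (1 - x) ^ (v - 1) : ℝ) : ℂ) := by
    rw [Complex.betaIntegral, ← intervalIntegral.integral_ofReal]
    refine intervalIntegral.integral_congr fun x hx => ?_
    rw [uIcc_of_le zero_le_one] at hx
    push_cast
    rw [Complex.ofReal_cpow hx.1, Complex.ofReal_cpow (by linarith [hx.2])]
    push_cast
    rfl
  rw [h2, Complex.ofReal_re, intervalIntegral_eq_integral_sigmoid, ProbabilityTheory.beta] at h
  rw [h]
  refine integral_congr_ae (ae_of_all _ fun s => ?_)
  simp only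
  rw [one_sub_sigmoid_eq_exp, sigmoid_eq_exp, ← Real.exp_mul, ← Real.exp_mul, ← Real.exp_add,
    ← Real.exp_add, ← Real.exp_add]
  congr 1
  ring

/-- Fold the Beta integral over the line at 0: `l(-s) = l(s) + s` turns the exponent `c` into `b` on
the negative side. The subtracted part is `1/(rb) + 1/(rc) = 1/(rbc)`. -/
theorem integral_exp_sub_one_mul_exp_add_exp {b c r : ℝ} (hb : 0 < b) (hc : 0 < c)
    (hbc : b + c = 1) (hr : 0 < r) :
    ∫ t in Ioi (0 : ℝ), (Real.exp (-1 * r * logOneAddExpNeg t) - 1) *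
        (Real.exp (-b * (r * t)) + Real.exp (-c * (r * t))) =
      Real.Gamma (r * b) * Real.Gamma (r * c) / Real.Gamma r - (r * b * c)⁻¹ := by
  have hB := integral_sigmoid_beta (mul_pos hr hb) (mul_pos hr hc)
  rw [← mul_add, hbc, mul_one] at hB
  set F : ℝ → ℝ := fun s => Real.exp (-r * logOneAddExpNeg s - r * c * s) with hF
  have hFi : Integrable F := by
    -- A non-integrable function has integral 0 by convention, whereas the Beta value is positive.
    by_contra hcon
    rw [integral_undef hcon] at hB
    have h1 := Real.Gamma_pos_of_pos (mul_pos hr hb)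
    have h2 := Real.Gamma_pos_of_pos (mul_pos hr hc)
    have h3 := Real.Gamma_pos_of_pos hr
    exact (div_pos (mul_pos h1 h2) h3).ne hB
  have hFneg : ∀ s, F (-s) = Real.exp (-1 * r * logOneAddExpNeg s) * Real.exp (-b * (r * s)) := by
    intro s
    rw [hF, ← Real.exp_add]
    simp only
    rw [logOneAddExpNeg_neg, show b = 1 - c by linarith]
    congr 1
    ring
  have hFpos : ∀ s, F s = Real.exp (-1 * r * logOneAddExpNeg s) * Real.exp (-c * (r * s)) := by
    intro s
    rw [hF, ← Real.exp_add]
    simp only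
    congr 1
    ring
  have hexp : ∀ z > 0, IntegrableOn (fun t : ℝ => Real.exp (-z * (r * t))) (Ioi 0) ∧
      ∫ t in Ioi (0 : ℝ), Real.exp (-z * (r * t)) = (r * z)⁻¹ := by
    intro z hz
    have h0 : -(z * r) < 0 := by nlinarith [mul_pos hz hr]
    have he : (fun t : ℝ => Real.exp (-z * (r * t))) = fun t => Real.exp (-(z * r) * t) := by
      funext t; congr 1; ring
    rw [he]
    refine ⟨integrableOn_exp_mul_Ioi h0 0, ?_⟩
    rw [integral_exp_mul_Ioi h0]
    simp only [mul_zero, Real.exp_zero]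
    field_simp
  rw [← intervalIntegral.integral_Iic_add_Ioi (b := 0) hFi.integrableOn hFi.integrableOn, ← neg_zero,
    ← integral_comp_neg_Ioi, neg_zero, ← integral_add hFi.comp_neg.integrableOn
    hFi.integrableOn] at hB
  rw [← hB]
  have hinv : (r * b * c)⁻¹ = ∫ t in Ioi (0 : ℝ),
      (Real.exp (-b * (r * t)) + Real.exp (-c * (r * t))) := by
    rw [integral_add (hexp b hb).1 (hexp c hc).1, (hexp b hb).2, (hexp c hc).2]
    field_simp
    linarith
  have hi1 : IntegrableOn (fun a => F (-a) + F a) (Ioi 0) :=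
    hFi.comp_neg.integrableOn.add hFi.integrableOn
  have hi2 : IntegrableOn (fun t : ℝ => Real.exp (-b * (r * t)) + Real.exp (-c * (r * t)))
      (Ioi 0) := (hexp b hb).1.add (hexp c hc).1
  rw [hinv, ← integral_sub hi1 hi2]
  refine integral_congr_ae (ae_of_all _ fun t => ?_)
  simp only [hFneg, hFpos]
  ring

/-- The function `e^(s/2) / (e^(s/2) + e^(-s/2))³`. -/
noncomputable def sigmoidWeight (s : ℝ) : ℝ :=
  Real.exp (1 / 2 * s) * ((Real.exp (1 / 2 * s) + Real.exp (-1 / 2 * s)) ^ 3)⁻¹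

theorem sigmoidWeight_eq (s : ℝ) :
    sigmoidWeight s = Real.sigmoid s ^ 2 * (1 - Real.sigmoid s) := by
  have h1 : Real.exp (-s) = Real.exp (-1 / 2 * s) * Real.exp (-1 / 2 * s) := by
    rw [← Real.exp_add]; congr 1; ring
  have h2 : Real.exp (1 / 2 * s) * Real.exp (-1 / 2 * s) = 1 := by
    rw [← Real.exp_add, ← Real.exp_zero]; congr 1; ring
  have hx := Real.exp_pos (1 / 2 * s)
  have hy := Real.exp_pos (-1 / 2 * s)
  rw [sigmoidWeight, Real.sigmoid_def, h1]
  set x := Real.exp (1 / 2 * s)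
  set y := Real.exp (-1 / 2 * s)
  have h3 : 1 + y * y = y * (x + y) := by rw [← h2]; ring
  have h4 : (1 + y * y)⁻¹ = x * (x + y)⁻¹ := by
    rw [h3, mul_inv]
    congr 1
    field_simp
    linarith
  have h5 : 1 - x * (x + y)⁻¹ = y * (x + y)⁻¹ := by
    field_simp
    ring
  rw [h4, h5]
  calc x * ((x + y) ^ 3)⁻¹ = (x * y) * x * ((x + y) ^ 3)⁻¹ := by rw [h2, one_mul]
    _ = _ := by field_simp

theorem continuous_sigmoidWeight : Continuous sigmoidWeight := by
  have : sigmoidWeight = fun s => Real.sigmoid s ^ 2 * (1 - Real.sigmoid s) :=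
    funext sigmoidWeight_eq
  rw [this]
  have := continuous_sigmoid
  fun_prop

theorem sigmoidWeight_nonneg (s : ℝ) : 0 ≤ sigmoidWeight s := by
  unfold sigmoidWeight; positivity

theorem sigmoidWeight_le_exp (s : ℝ) : sigmoidWeight s ≤ Real.exp (-s) := by
  have h0 := Real.sigmoid_pos s
  have h1 := Real.sigmoid_le_one s
  rw [sigmoidWeight_eq, ← Real.sigmoid_neg, ← Real.sigmoid_mul_rexp_neg, ← mul_assoc, ← pow_succ]
  exact mul_le_of_le_one_left (Real.exp_pos _).le (pow_le_one₀ h0.le h1)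

/-- Factoring out `σ(s)^n` leaves `1 + e^(-ns)`, and the symmetry `x ↔ 1-x` makes the integrand
even. The part without the `1/n`-th power is split off so that the rest can be rescaled by `t = ns`.
-/
theorem normIntegral_eq {n : ℝ} (hn : 0 < n) :
    normIntegral n = 2 * (∫ s in Ioi (0 : ℝ), sigmoidWeight s) + 2 * (n⁻¹ *
      ∫ t in Ioi (0 : ℝ), (Real.exp (1 * n⁻¹ * logOneAddExpNeg t) - 1) *
        sigmoidWeight (n⁻¹ * t)) := by
  set H : ℝ → ℝ := fun s => Real.sigmoid s * (1 - Real.sigmoid s) *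
    (Real.sigmoid s ^ n + (1 - Real.sigmoid s) ^ n) ^ (1 / n) with hH
  have heven : ∀ s, H s = H |s| := by
    intro s
    rcases abs_choice s with h | h <;> rw [h]
    simp only [hH]
    rw [Real.sigmoid_neg, sub_sub_cancel, add_comm, mul_comm (1 - Real.sigmoid s)]
  have hHeq : ∀ s, H s = sigmoidWeight s +
      (Real.exp (1 * n⁻¹ * logOneAddExpNeg (n * s)) - 1) * sigmoidWeight s := by
    intro s
    have h1 : Real.sigmoid s ^ n + (1 - Real.sigmoid s) ^ n =
        Real.exp (logOneAddExpNeg (n * s) - n * logOneAddExpNeg s) := by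
      rw [one_sub_sigmoid_eq_exp, sigmoid_eq_exp, ← Real.exp_mul, ← Real.exp_mul, Real.exp_sub,
        exp_logOneAddExpNeg, eq_div_iff (Real.exp_pos _).ne',
        add_mul, ← Real.exp_add, ← Real.exp_add]
      ring_nf
      simp
    have h2 : (logOneAddExpNeg (n * s) - n * logOneAddExpNeg s) * (1 / n) =
        1 * n⁻¹ * logOneAddExpNeg (n * s) + -logOneAddExpNeg s := by
      field_simp
      ring
    simp only [hH]
    rw [h1, ← Real.exp_mul, h2, Real.exp_add, ← sigmoid_eq_exp, sigmoidWeight_eq]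
    ring
  have hg : IntegrableOn sigmoidWeight (Ioi 0) := by
    refine (by simpa using integrableOn_pow_mul_exp_neg 0 :
      IntegrableOn (fun s : ℝ => Real.exp (-s)) (Ioi 0)).mono'
      continuous_sigmoidWeight.aestronglyMeasurable (ae_of_all _ fun s => ?_)
    rw [Real.norm_of_nonneg (sigmoidWeight_nonneg s)]
    exact sigmoidWeight_le_exp s
  have hg2 : IntegrableOn (fun s => (Real.exp (1 * n⁻¹ * logOneAddExpNeg (n * s)) - 1) *
      sigmoidWeight s) (Ioi 0) := by
    have := continuous_sigmoidWeight
    have := continuous_logOneAddExpNeg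
    refine (hg.const_mul (Real.exp n⁻¹)).mono' (Continuous.aestronglyMeasurable (by fun_prop))
      ((ae_restrict_iff' measurableSet_Ioi).2 (ae_of_all _ fun s (hs : 0 < s) => ?_))
    have h0 := logOneAddExpNeg_nonneg (n * s)
    have h1 := logOneAddExpNeg_le_one (mul_pos hn hs)
    have hn' := inv_pos.2 hn
    have h2 : 1 ≤ Real.exp (1 * n⁻¹ * logOneAddExpNeg (n * s)) := Real.one_le_exp (by positivity)
    have h3 : Real.exp (1 * n⁻¹ * logOneAddExpNeg (n * s)) ≤ Real.exp n⁻¹ := by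
      rw [Real.exp_le_exp]; nlinarith
    have h4 := sigmoidWeight_nonneg s
    rw [Real.norm_of_nonneg (mul_nonneg (by linarith) h4)]
    gcongr
    linarith
  have hscale := integral_comp_mul_left_Ioi (fun t => (Real.exp (1 * n⁻¹ * logOneAddExpNeg t) - 1) *
    sigmoidWeight (n⁻¹ * t)) 0 hn
  simp only [mul_zero, smul_eq_mul, inv_mul_cancel_left₀ hn.ne'] at hscale
  rw [normIntegral, intervalIntegral_eq_integral_sigmoid, ← hscale, ← mul_add,
    ← integral_add hg hg2]
  calc ∫ s, H s = ∫ s, H |s| := integral_congr_ae (ae_of_all _ heven)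
    _ = 2 * ∫ s in Ioi (0 : ℝ), H s := integral_comp_abs
    _ = _ := by
      congr 1
      exact integral_congr_ae (ae_of_all _ hHeq)

end

/-! ### The coefficients lie in the algebra of zeta values -/

section

open PowerSeries Topology

/-- This is `r ↦ -r` carried out on coefficients: the weight `e^(s/2)(e^(ys)+e^(-ys))` is unbounded
on `s > 0`, so the integral expansion applies only to its reflection. -/
theorem momentCoeff_neg_one_rescale (p : PowerSeries ℝ) (d : ℕ) :
    momentCoeff (-1) (rescale (-1) p) d = (-1) ^ d * momentCoeff 1 p d := by
  rw [momentCoeff, momentCoeff, Finset.mul_sum]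
  refine Finset.sum_congr rfl fun x hx => ?_
  rw [← Finset.HasAntidiagonal.mem_antidiagonal.1 hx, coeff_rescale, expSubOneCoeff,
    expSubOneCoeff]
  split_ifs
  · simp
  · rw [pow_add, one_pow]; ring

theorem coeff_mul_eq_sum_range_mul_X_pow {R : Type*} [CommRing R] (p q : PowerSeries R) {m d : ℕ}
    (h : m ≤ d) :
    coeff m (p * q) = ∑ i ∈ Finset.range (d + 1), coeff i q * coeff m (p * X ^ i) := by
  rw [mul_comm p q, coeff_mul, Finset.Nat.sum_antidiagonal_eq_sum_range_succ_mk]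
  apply Finset.sum_subset_zero_on_sdiff
  · exact Finset.range_subset_range.2 (by omega)
  · intro i hi
    simp only [Finset.mem_sdiff, Finset.mem_range] at hi
    rw [coeff_mul_X_pow', if_neg (by omega), mul_zero]
  · intro i hi
    rw [coeff_mul_X_pow', if_pos (by simpa [Nat.lt_succ_iff] using hi)]

theorem momentCoeff_mul (a : ℝ) (p q : PowerSeries ℝ) (d : ℕ) :
    momentCoeff a (p * q) d =
      ∑ i ∈ Finset.range (d + 1), coeff i q * momentCoeff a (p * X ^ i) d := by
  simp only [momentCoeff, Finset.mul_sum]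
  rw [Finset.sum_comm]
  refine Finset.sum_congr rfl fun x hx => ?_
  have hx := Finset.HasAntidiagonal.mem_antidiagonal.1 hx
  rw [coeff_mul_eq_sum_range_mul_X_pow p q (by omega : x.2 ≤ d), Finset.mul_sum, Finset.sum_mul]
  exact Finset.sum_congr rfl fun i _ => by ring

theorem hasRightExpansion_exp_mul (c : ℝ) :
    HasRightExpansion (fun s => Real.exp (c * s)) (rescale c (PowerSeries.exp ℝ)) := by
  intro N
  have h0 : Tendsto (fun s : ℝ => c * s) (𝓝[>] 0) (𝓝 0) := by
    have : Tendsto (fun s : ℝ => c * s) (𝓝 0) (𝓝 (c * 0)) := (continuous_const_mul c).tendsto 0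
    rw [mul_zero] at this
    exact this.mono_left nhdsWithin_le_nhds
  have h1 := (Real.exp_sub_sum_range_isBigO_pow N).comp_tendsto h0
  have h2 : (fun s : ℝ => (c * s) ^ N) =O[𝓝[>] 0] (fun s : ℝ => s ^ N) :=
    ((isBigO_refl (fun s : ℝ => s) (𝓝[>] 0)).const_mul_left c).pow N
  refine (h1.trans h2).congr_left fun s => ?_
  simp only [Function.comp]
  congr 1
  refine Finset.sum_congr rfl fun i _ => ?_
  rw [coeff_rescale, coeff_exp, mul_pow]
  simp only [map_div₀, map_one, map_natCast]
  ring

/-- The expansion of `1 / (e^(s/2) + e^(-s/2))³`. -/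
noncomputable def invCoshCubeSeries : PowerSeries ℚ :=
  ((rescale (1 / 2) (PowerSeries.exp ℚ) + rescale (-1 / 2) (PowerSeries.exp ℚ)) ^ 3)⁻¹

theorem coshCubeSeries_mul_inv :
    (rescale (1 / 2) (PowerSeries.exp ℚ) + rescale (-1 / 2) (PowerSeries.exp ℚ)) ^ 3 *
      invCoshCubeSeries = 1 := by
  refine PowerSeries.mul_inv_cancel _ ?_
  have h : ∀ c : ℚ, constantCoeff (rescale c (PowerSeries.exp ℚ)) = 1 := by
    intro c
    rw [← coeff_zero_eq_constantCoeff_apply, coeff_rescale]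
    simp
  rw [map_pow, map_add, h, h]
  norm_num

/-- Reflection swaps the two exponentials, so the inverse is fixed by it. -/
theorem coeff_invCoshCubeSeries_of_odd {i : ℕ} (hi : Odd i) : coeff i invCoshCubeSeries = 0 := by
  have h := congrArg (rescale (-1 : ℚ)) coshCubeSeries_mul_inv
  rw [map_mul, map_pow, map_add, rescale_rescale, rescale_rescale, map_one,
    show (-1 / 2 : ℚ) * -1 = 1 / 2 by norm_num, show (1 / 2 : ℚ) * -1 = -1 / 2 by norm_num,
    add_comm] at h
  have h2 : rescale (-1 : ℚ) invCoshCubeSeries = invCoshCubeSeries :=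
    (left_inv_eq_right_inv (by rw [mul_comm]; exact coshCubeSeries_mul_inv) h).symm
  have h3 := congrArg (coeff i) h2
  rw [coeff_rescale, hi.neg_one_pow] at h3
  linarith

/-- The expansion of `sigmoidWeight`. -/
noncomputable def sigmoidWeightSeries : PowerSeries ℝ :=
  rescale (1 / 2) (PowerSeries.exp ℝ) * PowerSeries.map (algebraMap ℚ ℝ) invCoshCubeSeries

theorem hasRightExpansion_sigmoidWeight : HasRightExpansion sigmoidWeight sigmoidWeightSeries := by
  refine (hasRightExpansion_exp_mul (1 / 2)).mul
    ((((hasRightExpansion_exp_mul (1 / 2)).add (hasRightExpansion_exp_mul (-1 / 2))).pow 3).inv ?_)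
  have h := congrArg (PowerSeries.map (algebraMap ℚ ℝ)) coshCubeSeries_mul_inv
  have hexp : ∀ c : ℚ, PowerSeries.map (algebraMap ℚ ℝ) (rescale c (PowerSeries.exp ℚ)) =
      rescale (c : ℝ) (PowerSeries.exp ℝ) := by
    intro c
    ext n
    simp
  rw [map_mul, map_pow, map_add, hexp, hexp, map_one] at h
  push_cast at h
  exact h

/-- Each coefficient is a universal rational polynomial in those of `p`. This lets the exponential
be formed over polynomials in `y` and evaluated afterwards. -/
theorem HasRightExpansion.map_expComp {R S : Type*} [CommRing R] [Algebra ℚ R] [CommRing S]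
    [Algebra ℚ S] (f : R →+* S) (p : PowerSeries R) :
    HasRightExpansion.expComp (PowerSeries.map f p) =
      PowerSeries.map f (HasRightExpansion.expComp p) := by
  ext n
  simp only [expComp, coeff_mk, coeff_map, map_sum, map_mul, RingHom.map_rat_algebraMap,
    ← map_pow]

/-- The `ℚ`-algebra generated by the zeta values `ζ(i)`, `i ≥ 2`. -/
noncomputable def zetaAlgebra : Subalgebra ℚ ℝ :=
  Algebra.adjoin ℚ (Set.range fun i : {i : ℕ // 2 ≤ i} => realZeta i)

theorem realZeta_mem {k : ℕ} (hk : 2 ≤ k) : realZeta k ∈ zetaAlgebra :=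
  Algebra.subset_adjoin ⟨⟨k, hk⟩, rfl⟩

theorem isRationalPolynomialInZetaValues_of_mem {x : ℝ} (hx : x ∈ zetaAlgebra) :
    IsRationalPolynomialInZetaValues x := by
  rw [zetaAlgebra, Algebra.adjoin_range_eq_range_aeval] at hx
  obtain ⟨P, rfl⟩ := hx
  refine ⟨P, ?_⟩
  have h : (fun i : {i : ℕ // 2 ≤ i} => riemannZeta ((i : ℕ) : ℂ)) =
      fun i : {i : ℕ // 2 ≤ i} => algebraMap ℝ ℂ (realZeta i) :=
    funext fun i => (ofReal_realZeta (by have := i.2; omega)).symm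
  rw [h]
  exact (MvPolynomial.aeval_algebraMap_apply ℂ (fun i : {i : ℕ // 2 ≤ i} => realZeta i) P).symm

/-- The family, polynomial in `y`, of the expansions of `log (r b c B(r b, r c))` for
`b = 1/2 - y` and `c = 1/2 + y`. -/
noncomputable def logBetaSeries : PowerSeries (Polynomial zetaAlgebra) :=
  PowerSeries.mk fun k => if h : k < 2 then 0 else
    algebraMap ℚ _ ((-1) ^ (k - 1) / k) *
      (1 - (algebraMap ℚ _ (1 / 2) - Polynomial.X) ^ k -
        (algebraMap ℚ _ (1 / 2) + Polynomial.X) ^ k) *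
      Polynomial.C ⟨realZeta k, realZeta_mem (not_lt.1 h)⟩

theorem map_aeval_logBetaSeries (y : ℝ) :
    PowerSeries.map (Polynomial.aeval (R := zetaAlgebra) y).toRingHom logBetaSeries =
      PowerSeries.mk (logBetaCoeff (1 / 2 - y) (1 / 2 + y)) := by
  ext k
  rw [coeff_map, logBetaSeries, coeff_mk, coeff_mk, logBetaCoeff]
  split_ifs with h
  · simp
  · have hq : ∀ q : ℚ, (Polynomial.aeval (R := zetaAlgebra) y).toRingHom (algebraMap ℚ _ q) =
        (q : ℝ) := fun q => by
      rw [RingHom.map_rat_algebraMap]; simp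
    have hX : (Polynomial.aeval (R := zetaAlgebra) y).toRingHom Polynomial.X = y :=
      Polynomial.aeval_X y
    have hC : (Polynomial.aeval (R := zetaAlgebra) y).toRingHom
        (Polynomial.C ⟨realZeta k, realZeta_mem (not_lt.1 h)⟩) = realZeta k :=
      Polynomial.aeval_C y _
    rw [map_mul, map_mul, map_sub, map_sub, map_pow, map_pow, map_sub, map_add, hq, hq, hX, hC,
      map_one]
    push_cast
    ring

/-- Both sides come from expanding `r b c B(rb, rc)`, once through the moment integral and once
through the exponential of the zeta series. The factor `r` before the integral shifts the degree by
one. -/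
theorem mul_momentCoeff_exp_add_exp {b c : ℝ} (hb : 0 < b) (hc : 0 < c) (hbc : b + c = 1)
    (d : ℕ) :
    b * c * momentCoeff (-1)
        (rescale (-b) (PowerSeries.exp ℝ) + rescale (-c) (PowerSeries.exp ℝ)) d =
      coeff (d + 1) (HasRightExpansion.expComp (PowerSeries.mk (logBetaCoeff b c))) := by
  have hK := hasRightExpansion_integral_exp_sub_one (-1)
    (φ := fun s => Real.exp (-b * s) + Real.exp (-c * s)) (by fun_prop)
    ((hasRightExpansion_exp_mul (-b)).add (hasRightExpansion_exp_mul (-c))) (B := 1 + 1) (by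
      intro s hs
      rw [abs_of_pos (by positivity)]
      gcongr <;> rw [Real.exp_le_one_iff] <;> nlinarith)
  have hL := (hasRightExpansion_tsum_logBetaTerm hb hc hbc).exp (by
    rw [← coeff_zero_eq_constantCoeff_apply, coeff_mk]; simp [logBetaCoeff])
  have h1 := ((HasRightExpansion.id.mul hK).const_mul (b * c)).add (HasRightExpansion.const 1)
  have h2 := hL.congr' (g := fun r => b * c * (r * ∫ t in Set.Ioi (0 : ℝ),
      (Real.exp (-1 * r * logOneAddExpNeg t) - 1) *
        (Real.exp (-b * (r * t)) + Real.exp (-c * (r * t)))) + 1) (by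
    filter_upwards [Ioo_mem_nhdsGT (by norm_num : (0 : ℝ) < 1 / 2)] with r hr
    have hr0 := hr.1
    have g1 := Real.Gamma_pos_of_pos (mul_pos hr0 hb)
    have g2 := Real.Gamma_pos_of_pos (mul_pos hr0 hc)
    have g3 := Real.Gamma_pos_of_pos hr0
    rw [integral_exp_sub_one_mul_exp_add_exp hb hc hbc hr0,
      ← log_Gamma_eq_tsum_logBetaTerm hb hc hbc hr0 hr.2.le, Real.exp_add, Real.exp_sub,
      Real.exp_add, Real.exp_log g1, Real.exp_log g2, Real.exp_log g3,
      Real.exp_log (by positivity)]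
    field_simp
    ring)
  have h3 := congrArg (coeff (d + 1)) (h2.unique h1)
  rw [h3, map_add, coeff_C_mul, coeff_succ_X_mul, coeff_mk, coeff_C, if_neg (by omega), add_zero]

theorem rescale_exp_add_rescale_exp (y : ℝ) :
    rescale (-(1 / 2 - y)) (PowerSeries.exp ℝ) + rescale (-(1 / 2 + y)) (PowerSeries.exp ℝ) =
      rescale (-1) (rescale (1 / 2) (PowerSeries.exp ℝ) *
        (rescale (-y) (PowerSeries.exp ℝ) + rescale y (PowerSeries.exp ℝ))) := by
  rw [mul_add, exp_mul_exp_eq_exp_add, exp_mul_exp_eq_exp_add, map_add, rescale_rescale,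
    rescale_rescale]
  congr 3 <;> ring

theorem Polynomial.coeff_mem_of_mul_eq_map {A : Subalgebra ℚ ℝ} {P : Polynomial ℝ}
    {w q : Polynomial A} (hw : w.Monic)
    (h : w.map (algebraMap A ℝ) * P = q.map (algebraMap A ℝ)) (i : ℕ) : P.coeff i ∈ A := by
  have hP : P = (q /ₘ w).map (algebraMap A ℝ) := by
    rw [Polynomial.map_divByMonic _ hw, ← h, Polynomial.mul_divByMonic_cancel_left _ (hw.map _)]
  rw [hP, Polynomial.coeff_map]
  exact ((q /ₘ w).coeff i).2

/-- The quantity is, up to the rational factor `2/i!`, the coefficient of `y^i` in a polynomial `P`,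
and `(1/4-y²) P` has coefficients in the zeta algebra. Odd `i` is invisible, since `e^(ys)+e^(-ys)`
is even in `y`. -/
theorem momentCoeff_exp_mul_X_pow_mem {d i : ℕ} (hi : Even i) (hid : i ≤ d) :
    momentCoeff 1 (rescale (1 / 2) (PowerSeries.exp ℝ) * X ^ i) d ∈ zetaAlgebra := by
  set E := rescale (1 / 2) (PowerSeries.exp ℝ) with hE
  set P : Polynomial ℝ := ∑ j ∈ Finset.range (d + 1), Polynomial.monomial j
    (((-1) ^ j + 1) / (j.factorial : ℝ) * momentCoeff 1 (E * X ^ j) d) with hP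
  set Q := coeff (d + 1) (HasRightExpansion.expComp logBetaSeries) with hQ
  have hPeval : ∀ y : ℝ, P.eval y = momentCoeff 1
      (E * (rescale (-y) (PowerSeries.exp ℝ) + rescale y (PowerSeries.exp ℝ))) d := by
    intro y
    rw [momentCoeff_mul, hP, Polynomial.eval_finsetSum]
    refine Finset.sum_congr rfl fun j _ => ?_
    rw [Polynomial.eval_monomial, map_add, coeff_rescale, coeff_rescale, coeff_exp, neg_pow]
    simp only [map_div₀, map_one, map_natCast]
    ring
  have hkey : ∀ y ∈ Set.Ioo (-(1 / 2) : ℝ) (1 / 2),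
      (1 / 2 - y) * (1 / 2 + y) * ((-1) ^ d * P.eval y) = Polynomial.aeval y Q := by
    intro y hy
    have h := mul_momentCoeff_exp_add_exp (b := 1 / 2 - y) (c := 1 / 2 + y) (by linarith [hy.2])
      (by linarith [hy.1]) (by ring) d
    rw [rescale_exp_add_rescale_exp, momentCoeff_neg_one_rescale, ← map_aeval_logBetaSeries,
      HasRightExpansion.map_expComp, coeff_map, ← hE, ← hPeval] at h
    exact h
  -- This is `-bc`, made monic for the division; its sign turns `(-1)^d` into `(-1)^(d+1)`.
  set w : Polynomial zetaAlgebra := Polynomial.X ^ 2 - Polynomial.C (algebraMap ℚ _ (1 / 4))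
  have hw : w.Monic := Polynomial.monic_X_pow_sub_C _ two_ne_zero
  have hmul : w.map (algebraMap zetaAlgebra ℝ) * P =
      (Polynomial.C ((-1) ^ (d + 1)) * Q).map (algebraMap zetaAlgebra ℝ) := by
    -- The Beta integral needs `b, c > 0`, but agreement on this interval determines the
    -- polynomials.
    refine Polynomial.eq_of_infinite_eval_eq _ _
      ((Set.Ioo_infinite (by norm_num : (-(1 / 2) : ℝ) < 1 / 2)).mono fun y hy => ?_)
    have h := hkey y hy
    have hd : ((-1 : ℝ) ^ d) * (-1) ^ d = 1 := by rw [← mul_pow]; simp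
    simp only [w, Set.mem_ofPred_eq, Polynomial.eval_mul, Polynomial.eval_map_algebraMap, map_mul,
      map_sub, map_pow, Polynomial.aeval_X, Polynomial.aeval_C, ← h, map_neg, map_one]
    rw [RingHom.map_rat_algebraMap, eq_ratCast]
    push_cast
    rw [pow_succ]
    linear_combination ((1 / 4 - y ^ 2) * P.eval y) * hd
  have hmem := Polynomial.coeff_mem_of_mul_eq_map hw hmul i
  have hc : P.coeff i = (2 / (i.factorial : ℝ)) * momentCoeff 1 (E * X ^ i) d := by
    rw [hP, Polynomial.finsetSum_coeff]
    simp only [Polynomial.coeff_monomial]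
    rw [Finset.sum_ite_eq' , if_pos (Finset.mem_range.2 (by omega)), hi.neg_one_pow]
    norm_num
  have hfin := zetaAlgebra.smul_mem hmem ((i.factorial : ℚ) / 2)
  rw [hc, Algebra.smul_def] at hfin
  convert hfin using 1
  simp only [eq_ratCast]
  push_cast
  have := i.factorial_ne_zero
  field_simp

theorem momentCoeff_sigmoidWeightSeries_mem (d : ℕ) :
    momentCoeff 1 sigmoidWeightSeries d ∈ zetaAlgebra := by
  rw [sigmoidWeightSeries, momentCoeff_mul]
  refine Subalgebra.sum_mem _ fun i hi => ?_
  rw [coeff_map]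
  rcases Nat.even_or_odd i with h | h
  · exact mul_mem (Subalgebra.algebraMap_mem _ _)
      (momentCoeff_exp_mul_X_pow_mem h (by simpa [Nat.lt_succ_iff] using hi))
  · rw [coeff_invCoshCubeSeries_of_odd h, map_zero, zero_mul]
    exact zero_mem _

/-! ### Uniqueness and the final expansion -/

theorem HasAsymptoticSeries.unique {l : Filter ℝ} [l.NeBot] (hl : l ≤ atTop) {f : ℝ → ℝ}
    {c c' : ℕ → ℝ} (h : HasAsymptoticSeries l f c) (h' : HasAsymptoticSeries l f c') :
    c' = c := by
  funext N
  induction N using Nat.strong_induction_on with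
  | _ N ih =>
    have h1 := (h N).sub (h' N)
    have hne : ∀ᶠ t : ℝ in l, t ≠ 0 := (eventually_ne_atTop 0).filter_mono hl
    have h2 : (fun _ : ℝ => c' N - c N) =o[l] (fun _ : ℝ => (1 : ℝ)) := by
      have h3 := h1.mul_isBigO (isBigO_refl (fun t : ℝ => t ^ N) l)
      refine h3.congr' (hne.mono fun t ht => ?_) (hne.mono fun t ht => ?_)
      · have hs : ∑ j ∈ Finset.range N, c' j / t ^ j = ∑ j ∈ Finset.range N, c j / t ^ j :=
          Finset.sum_congr rfl fun j hj => by rw [ih j (Finset.mem_range.1 hj)]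
        simp only [Finset.sum_range_succ, hs]
        field_simp
        ring
      · field_simp
    have h4 := (isLittleO_one_iff ℝ).1 h2
    exact sub_eq_zero.1 (tendsto_nhds_unique tendsto_const_nhds h4)

/-- The coefficients of the asymptotic series of `normIntegral`. -/
noncomputable def normIntegralCoeff : ℕ → ℝ
  | 0 => 2 * ∫ s in Set.Ioi (0 : ℝ), sigmoidWeight s
  | d + 1 => 2 * momentCoeff 1 sigmoidWeightSeries d

theorem hasAsymptoticSeries_normIntegral :
    HasAsymptoticSeries atTop normIntegral normIntegralCoeff := by
  have hK := hasRightExpansion_integral_exp_sub_one 1 continuous_sigmoidWeight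
    hasRightExpansion_sigmoidWeight (B := 1) (by
      intro s hs
      rw [abs_of_nonneg (sigmoidWeight_nonneg s)]
      exact (sigmoidWeight_le_exp s).trans (Real.exp_le_one_iff.2 (by linarith)))
  have h1 := (HasRightExpansion.const (2 * ∫ s in Set.Ioi (0 : ℝ), sigmoidWeight s)).add
    ((HasRightExpansion.id.mul hK).const_mul 2)
  intro N
  -- Substituting `r = 1/t` at order `N + 1` turns the `O` bound into the required `o(t^(-N))`.
  have h2 := (h1 (N + 1)).comp_tendsto tendsto_inv_atTop_nhdsGT_zero
  have h3 : (fun t : ℝ => t⁻¹ ^ (N + 1)) =o[atTop] (fun t : ℝ => (t ^ N)⁻¹) := by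
    have h4 : (fun t : ℝ => t⁻¹) =o[atTop] (fun _ : ℝ => (1 : ℝ)) :=
      (isLittleO_one_iff ℝ).2 tendsto_inv_atTop_zero
    refine (h4.mul_isBigO (isBigO_refl (fun t : ℝ => (t ^ N)⁻¹) atTop)).congr
      (fun t => by rw [pow_succ, inv_pow]; ring) (fun t => one_mul _)
  refine (h2.trans_isLittleO h3).congr' ?_ EventuallyEq.rfl
  filter_upwards [eventually_gt_atTop 0] with t ht
  simp only [Function.comp]
  rw [normIntegral_eq ht]
  congr 1
  refine Finset.sum_congr rfl fun j _ => ?_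
  rw [inv_pow, div_eq_mul_inv]
  congr 1
  rcases j with _ | d
  · simp [normIntegralCoeff]
  · rw [map_add, coeff_C_mul, coeff_succ_X_mul, coeff_mk, coeff_C, if_neg (by omega), zero_add,
      normIntegralCoeff]

end

theorem mainTheorem3 :
    ∃ I : ℕ → ℝ,
      HasAsymptoticSeries Filter.atTop normIntegral I ∧
      (∀ I' : ℕ → ℝ, HasAsymptoticSeries integersAtTop normIntegral I' → I' = I) ∧
      ∀ p : ℕ, 2 ≤ p → IsRationalPolynomialInZetaValues ((I p : ℝ) : ℂ) := by
  have hle : integersAtTop ≤ atTop := tendsto_natCast_atTop_atTop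
  have : integersAtTop.NeBot := map_neBot
  refine ⟨normIntegralCoeff, hasAsymptoticSeries_normIntegral, fun I' hI' => ?_, fun p hp => ?_⟩
  · exact HasAsymptoticSeries.unique hle
      (fun N => (hasAsymptoticSeries_normIntegral N).mono hle) hI'
  · obtain ⟨d, rfl⟩ : ∃ d, p = d + 1 := ⟨p - 1, by omega⟩
    refine isRationalPolynomialInZetaValues_of_mem ?_
    have h := zetaAlgebra.smul_mem (momentCoeff_sigmoidWeightSeries_mem d) (2 : ℚ)
    rw [Algebra.smul_def] at h
    simpa [normIntegralCoeff] using h
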